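/- Let $I$ be a finite set of advertisers and $J$ a finite set of slots. Each advertiser is either pay-per-click (CPC) or pay-per-impression (CPM). For each CPC advertiser $i$ and slot $j$ the search engine publicly announces an estimate $\hat c_i^j>0$ of the clickthrough rate. Advertiser $i$ has utility $u_i^j(x)$ for slot $j$ when she pays $x$ (per click if CPC, per impression if CPM), where $u_i^j:\mathbb R\to\mathbb R$ is continuous, strictly decreasing and non-positive for large $x$, and utility $0$ if she gets no slot and pays nothing. Put $g_i^j(x)=x/\hat c_i^j$ if $i$ is CPC and $g_i^j(x)=x$ if $i$ is CPM. A competitive equilibrium (with personalised prices $g_i^j$) consists of primary prices $p^j\ge 0$ $(j\in J)$ and payoffs $U_i\ge 0$ $(i\in I)$ for which there is a supporting matching, i.e. a partial one-to-one assignment $\mu$ of slots to advertisers with $U_i\ge u_i^j(g_i^j(p^j))$ for all $i,j$, with equality if $\mu(i)=j$; $U_i=0$ if $i$ is unmatched; and $p^j=0$ if $j$ is unmatched. It is the lowest one if it has the lowest prices and the highest payoffs, componentwise, among all competitive equilibria. The mechanism takes the reported utility functions, computes the lowest competitive equilibrium, assigns slots by any supporting matching $\mu$ of it, and charges $g_i^j(p^j)$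 to an advertiser $i$ with $\mu(i)=j$ and nothing to unmatched advertisers. Then: 1. (Well-definedness.) For all such utility functions the lowest competitive equilibrium exists and is unique. 2. (Group strategyproofness.) There is no non-empty coalition $S\subseteq I$ that can misreport its utility functions (within the above class, the reports of the advertisers outside $S$ being fixed) so that every member of $S$ gets a strictly higher payoff, evaluated with her true utility functions, than when $S$ reports truthfully. This holds for arbitrary $\hat c_i^j>0$, whether or not the advertisers agree with them, and for any choice of the supporting matchings. Say that $i$ has standard utility functions with values $v_i^j$ if for all $j$ and $x$: $u_i^j(x)=c_i^j(v_i^j-x)$ when $i$ is CPC, where $c_i^j$ is her belief about her clickthrough rate, and $u_i^j(x)=v_i^j-x$ when $i$ is CPM; a CPC advertiser agrees with the search engine if $c_i^j=\hat c_i^j$ for all $j$ (for a CPM advertiser nothing is required). Let $A\subseteq I$ be any group of advertisers who have standard utility functions, agree with the search engine, and report them truthfully; let $A'=I\setminus A$, and let the reports of $A'$ be arbitrary utility functions as above. The welfare of the search engine $s$ together with $A$ at an outcome is the expected revenue of $s$ from all advertisers (computed with the rates $\hat c_i^j$) plus the sum of the payoffs of the members of $A$. 3. (Welfare maximisation.)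 Let $p$ be the primary prices computed by the mechanism. The outcome of the mechanism maximises the welfare of $\{s\}\cup A$ among all assignments of slots and payments in which each advertiser $i\in A'$ who gets a slot $j$ pays at most $g_i^j(p^j)$ (payments of members of $A$ being arbitrary); in particular, the welfare of $\{s\}\cup A$ is at least the largest one attainable when slots are given only to members of $A$. 4. (The others do no harm.) The welfare of $\{s\}\cup A$ at the outcome of the mechanism is at least its welfare at the outcome of the mechanism in the auction in which only the advertisers in $A$ are present. 5. (VCG.) If all advertisers have standard utility functions and agree with the search engine (so $A=I$), then the outcomes of the mechanism are exactly the VCG outcomes for the values per impression $w_i^j=\hat c_i^j v_i^j$ (CPC), $w_i^j=v_i^j$ (CPM): the assignment maximises $\sum_i w_i^{\mu(i)}$ (with $w_i^{\mu(i)}=0$ for unmatched $i$), and the expected payment per impression of each $i$ is the maximum of $\sum_{k\ne i}w_k^{\sigma(k)}$ over all assignments $\sigma$ minus $\sum_{k\neq i}w_k^{\mu(k)}$. -/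

import Mathlib

/-- Assumptions on the utility `f x` of one advertiser (buyer) from one slot (good), as a function
of the price `x` she is charged for it. -/
structure IsUtility (f : ℝ → ℝ) : Prop where
  continuous : Continuous f
  strictAnti : StrictAnti f
  exists_nonpos : ∃ x, f x ≤ 0

/-- A feasible assignment: `μ i` is the good of buyer `i` (`none` if she is unmatched), and no good
is given to two buyers. -/
def IsMatching {I J : Type*} (μ : I → Option J) : Prop :=
  ∀ i i' j, μ i = some j → μ i' = some j → i = i'

/-- `μ` is a supporting matching for prices `p` and payoffs `U` in the market `(I, J, u)`. -/
structure Supports {I J : Type*} (u : I → J → ℝ → ℝ) (p : J → ℝ) (U : I → ℝ)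
    (μ : I → Option J) : Prop where
  isMatching : IsMatching μ
  payoff_eq : ∀ i j, μ i = some j → U i = u i j (p j)
  payoff_ge : ∀ i j, u i j (p j) ≤ U i
  payoff_unmatched : ∀ i, μ i = none → U i = 0
  price_unmatched : ∀ j, (∀ i, μ i ≠ some j) → p j = 0
  payoff_nonneg : ∀ i, 0 ≤ U i
  price_nonneg : ∀ j, 0 ≤ p j

/-- The pair of a price vector `p` and a payoff vector `U` is a competitive equilibrium. -/
def IsCompetitiveEquilibrium {I J : Type*} (u : I → J → ℝ → ℝ) (p : J → ℝ) (U : I → ℝ) : Prop :=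
  ∃ μ, Supports u p U μ

/-- The competitive equilibrium with the lowest prices and the highest payoffs. -/
def IsLowestEquilibrium {I J : Type*} (u : I → J → ℝ → ℝ) (p : J → ℝ) (U : I → ℝ) : Prop :=
  IsCompetitiveEquilibrium u p U ∧
    ∀ p' U', IsCompetitiveEquilibrium u p' U' → p ≤ p' ∧ U' ≤ U

/-- How an advertiser is charged. -/
inductive PaymentKind where
  | perClick
  | perImpression

/-- The public data of an ad auction with advertisers `I` and slots `J`: the payment kind of every
advertiser and the search engine's estimates `ctr i j` of the clickthrough rates. -/
structure AdAuction (I J : Type*) where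
  kind : I → PaymentKind
  ctr : I → J → ℝ
  ctr_pos : ∀ i j, kind i = PaymentKind.perClick → 0 < ctr i j

/-- An outcome: a feasible assignment of slots, and for each advertiser the payment she is charged,
per click or per impression according to her kind. Advertisers without a slot pay nothing. -/
structure Outcome (I J : Type*) where
  slot : I → Option J
  isMatching : IsMatching slot
  pay : I → ℝ
  pay_unmatched : ∀ i, slot i = none → pay i = 0

/-- The payoff of advertiser `i`, with utility functions `u`, from an outcome. -/
def payoff {I J : Type*} (u : I → J → ℝ → ℝ) (o : Outcome I J) (i : I) : ℝ :=
  (o.slot i).elim 0 (fun j => u i j (o.pay i))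

namespace AdAuction

variable {I J : Type*}

/-- The personalised price seen by advertiser `i` if the primary price of slot `j` is `x`. -/
noncomputable def personalPrice (P : AdAuction I J) (i : I) (j : J) (x : ℝ) : ℝ :=
  match P.kind i with
  | PaymentKind.perClick => x / P.ctr i j
  | PaymentKind.perImpression => x

/-- The market in terms of primary prices: utilities composed with the personalised prices. -/
noncomputable def market (P : AdAuction I J) (u : I → J → ℝ → ℝ) : I → J → ℝ → ℝ :=
  fun i j x => u i j (P.personalPrice i j x)

/-- `o` is an outcome of the ad-auction mechanism on the reported utilities `u`, with primary slot
prices `p`: these are the prices of the lowest competitive equilibrium for the personalised prices,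
the slots are assigned by any of its supporting matchings, and every advertiser with a slot pays
her personalised price for it. -/
def IsMechanismOutcome (P : AdAuction I J) (u : I → J → ℝ → ℝ) (p : J → ℝ)
    (o : Outcome I J) : Prop :=
  ∃ U, IsLowestEquilibrium (P.market u) p U ∧ Supports (P.market u) p U o.slot ∧
    ∀ i j, o.slot i = some j → o.pay i = P.personalPrice i j (p j)

/-- The payment that the search engine expects (with its own clickthrough rates) from advertiser
`i` for one impression. -/
noncomputable def expectedPayment (P : AdAuction I J) (o : Outcome I J) (i : I) : ℝ :=
  (o.slot i).elim 0 (fun j =>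
    match P.kind i with
    | PaymentKind.perClick => P.ctr i j * o.pay i
    | PaymentKind.perImpression => o.pay i)

/-- The welfare of the search engine (its expected revenue from all advertisers) together with
the group `A` of advertisers. -/
noncomputable def welfare [Fintype I] (P : AdAuction I J) (u : I → J → ℝ → ℝ) (A : Finset I)
    (o : Outcome I J) : ℝ :=
  ∑ i, P.expectedPayment o i + ∑ i ∈ A, payoff u o i

/-- The auction in which only the advertisers in `A` are present. -/
def restrict (P : AdAuction I J) (A : Finset I) : AdAuction A J where
  kind i := P.kind i
  ctr i := P.ctr i
  ctr_pos i j h := P.ctr_pos i j h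

/-- Advertiser `i` with utility functions `f` has standard utility functions for the values `v`
(per click or per impression) and, for a pay-per-click advertiser, the believed clickthrough rates
`c`. -/
def IsStandard (P : AdAuction I J) (i : I) (c v : J → ℝ) (f : J → ℝ → ℝ) : Prop :=
  match P.kind i with
  | PaymentKind.perClick => ∀ j x, f j x = c j * (v j - x)
  | PaymentKind.perImpression => ∀ j x, f j x = v j - x

/-- The beliefs `c` of advertiser `i` on clickthrough rates agree with those of the search engine;
beliefs of pay-per-impression advertisers play no role. -/
def Agrees (P : AdAuction I J) (i : I) (c : J → ℝ) : Prop :=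
  P.kind i = PaymentKind.perClick → ∀ j, c j = P.ctr i j

/-- The expected value per impression of a slot for a standard advertiser. -/
noncomputable def impressionValue (P : AdAuction I J) (c v : I → J → ℝ) (i : I) (j : J) : ℝ :=
  match P.kind i with
  | PaymentKind.perClick => c i j * v i j
  | PaymentKind.perImpression => v i j

/-- The value that `i` gets under the assignment `σ` if slot `j` is worth `w i j` to her. -/
noncomputable def assignedValue (w : I → J → ℝ) (σ : I → Option J) (i : I) : ℝ :=
  (σ i).elim 0 (w i)

/-- `o` is a VCG outcome for the values per impression `w`: the assignment maximises the total
value, and the expected payment of every advertiser is the externality she imposes on the other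
advertisers (the maximal total value of the others minus their actual total value). -/
def IsVCGOutcome [Fintype I] [DecidableEq I] (P : AdAuction I J) (w : I → J → ℝ)
    (o : Outcome I J) : Prop :=
  (∀ σ : I → Option J, IsMatching σ →
      ∑ i, assignedValue w σ i ≤ ∑ i, assignedValue w o.slot i) ∧
    ∀ i, P.expectedPayment o i =
      (⨆ σ : {σ : I → Option J // IsMatching σ},
          ∑ k ∈ Finset.univ.erase i, assignedValue w σ.1 k) -
        ∑ k ∈ Finset.univ.erase i, assignedValue w o.slot k

end AdAuction

/-! Composing utilities with the personalised prices (`AdAuction.market`) stays within the class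
`IsUtility`. So the auction is a one-to-one matching market with a single price per good, and the
estimated clickthrough rates only rescale utilities, whether or not anyone believes them.

Existence: an ascending auction with increment `ε` ends in an approximate equilibrium
(`exists_approxSupports`), and compactness lets `ε` tend to 0. The merging lemma `Supports.merge`
shows that the componentwise minimum of two equilibrium price vectors is again one. On the compact
set of equilibrium prices, a vector of minimal sum is therefore the lowest.

Group strategyproofness: suppose that a misreport leads to prices `q` at which all of `S` gains. Let
`N` be the set of all buyers who gain. They merely permute among themselves the goods that they hold
in the lowest equilibrium, at prices below the lowest `p`, and nobody outside `N` would gain at `q`.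
With `q` as reserve prices on these goods, `Supports.exists_lower` builds a true equilibrium that is
cheaper somewhere, a contradiction.

Welfare and VCG rest on linear programming duality for the assignment problem: payoffs and prices
form a dual feasible solution, tight on a supporting matching. The highest equilibrium payoff of a
buyer is her marginal contribution to the total value (`IsLowestEquilibrium.payoff_eq_sub`), which
is the VCG payoff. -/

/-- The payoffs of the buyers if the goods are assigned by `μ` and priced by `p`. -/
def assignedPayoff {I J : Type*} (u : I → J → ℝ → ℝ) (μ : I → Option J) (p : J → ℝ) (i : I) : ℝ :=
  (μ i).elim 0 (fun j => u i j (p j))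

/-! ### Exact and approximate equilibria -/

section Assigned

variable {I J : Type*} {u : I → J → ℝ → ℝ} {μ : I → Option J} {p : J → ℝ} {i : I} {j : J}

theorem assignedPayoff_none (h : μ i = none) : assignedPayoff u μ p i = 0 := by
  simp [assignedPayoff, h]

theorem assignedPayoff_some (h : μ i = some j) : assignedPayoff u μ p i = u i j (p j) := by
  simp [assignedPayoff, h]

theorem Supports.eq_assignedPayoff {U : I → ℝ} (h : Supports u p U μ) (i : I) :
    U i = assignedPayoff u μ p i := by
  cases hi : μ i with
  | none => rw [h.payoff_unmatched i hi, assignedPayoff_none hi]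
  | some j => rw [h.payoff_eq i j hi, assignedPayoff_some hi]

theorem Supports.exists_matched {U : I → ℝ} (h : Supports u p U μ) (hj : 0 < p j) :
    ∃ i, μ i = some j := by
  by_contra! hn
  exact hj.ne' (h.price_unmatched j hn)

theorem Supports.matched_of_pos {U : I → ℝ} (h : Supports u p U μ) (hi : 0 < U i) :
    ∃ j, μ i = some j := by
  cases hm : μ i with
  | none => exact absurd (h.payoff_unmatched i hm) hi.ne'
  | some j => exact ⟨j, rfl⟩

/-- Supporting matchings up to an error of `ε`: buyers compare their payoff with the payoffs at
prices increased by `ε`. -/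
structure ApproxSupports (u : I → J → ℝ → ℝ) (ε : ℝ) (p : J → ℝ) (μ : I → Option J) : Prop where
  isMatching : IsMatching μ
  payoff_ge : ∀ i j, u i j (p j + ε) ≤ assignedPayoff u μ p i
  payoff_nonneg : ∀ i, 0 ≤ assignedPayoff u μ p i
  price_unmatched : ∀ j, (∀ i, μ i ≠ some j) → p j = 0
  price_nonneg : ∀ j, 0 ≤ p j

theorem approxSupports_zero_iff :
    ApproxSupports u 0 p μ ↔ ∃ U, Supports u p U μ := by
  constructor
  · intro h
    refine ⟨assignedPayoff u μ p, h.isMatching, fun i j hij => assignedPayoff_some hij,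
      fun i j => by simpa using h.payoff_ge i j, fun i hi => assignedPayoff_none hi,
      h.price_unmatched, h.payoff_nonneg, h.price_nonneg⟩
  · rintro ⟨U, h⟩
    have hU : U = assignedPayoff u μ p := funext h.eq_assignedPayoff
    subst hU
    exact ⟨h.isMatching, fun i j => by simpa using h.payoff_ge i j, h.payoff_nonneg,
      h.price_unmatched, h.price_nonneg⟩

theorem exists_isCompetitiveEquilibrium_iff :
    (∃ U, IsCompetitiveEquilibrium u p U) ↔ ∃ μ, ApproxSupports u 0 p μ := by
  simp only [approxSupports_zero_iff, IsCompetitiveEquilibrium]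
  exact exists_comm

theorem ApproxSupports.le_of_nonpos {ε M : ℝ} (hu : ∀ i j, IsUtility (u i j))
    (hM : 0 ≤ M) (hMu : ∀ i j, u i j M ≤ 0) (h : ApproxSupports u ε p μ) (j : J) : p j ≤ M := by
  by_contra! hlt
  have hpos : p j ≠ 0 := (hM.trans_lt hlt).ne'
  obtain ⟨i, hi⟩ : ∃ i, μ i = some j := by
    by_contra! hn
    exact hpos (h.price_unmatched j hn)
  have h1 := h.payoff_nonneg i
  rw [assignedPayoff_some hi] at h1
  linarith [(hu i j).strictAnti hlt, hMu i j]

/-- The error is a variable alongside the prices so that it can tend to 0. The matching is fixed: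
there are only finitely many, so a finite union recovers the general case. -/
theorem isClosed_approxSupports (hu : ∀ i j, IsUtility (u i j)) (μ : I → Option J) :
    IsClosed {x : ℝ × (J → ℝ) | ApproxSupports u x.1 x.2 μ} := by
  by_cases hμ : IsMatching μ
  swap
  · convert isClosed_empty
    ext x
    simpa using fun h : ApproxSupports u x.1 x.2 μ => hμ h.isMatching
  have hc : ∀ i, Continuous fun x : ℝ × (J → ℝ) => assignedPayoff u μ x.2 i := by
    intro i
    cases hi : μ i with
    | none => simpa [assignedPayoff, hi] using continuous_const
    | some j =>
      simp only [assignedPayoff, hi, Option.elim_some]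
      exact (hu i j).continuous.comp (by fun_prop)
  have heq : {x : ℝ × (J → ℝ) | ApproxSupports u x.1 x.2 μ} =
      (⋂ i, ⋂ j, {x | u i j (x.2 j + x.1) ≤ assignedPayoff u μ x.2 i}) ∩
      (⋂ i, {x | 0 ≤ assignedPayoff u μ x.2 i}) ∩
      (⋂ j, ⋂ (_ : ∀ i, μ i ≠ some j), {x | x.2 j = 0}) ∩ (⋂ j, {x | 0 ≤ x.2 j}) := by
    ext x
    simp only [Set.mem_inter_iff, Set.mem_iInter, Set.mem_ofPred_eq]
    exact ⟨fun h => ⟨⟨⟨h.payoff_ge, h.payoff_nonneg⟩, h.price_unmatched⟩, h.price_nonneg⟩,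
      fun h => ⟨hμ, h.1.1.1, h.1.1.2, h.1.2, h.2⟩⟩
  rw [heq]
  refine ((IsClosed.inter ?_ ?_).inter ?_).inter ?_
  · exact isClosed_iInter fun i => isClosed_iInter fun j =>
      isClosed_le ((hu i j).continuous.comp (by fun_prop)) (hc i)
  · exact isClosed_iInter fun i => isClosed_le continuous_const (hc i)
  · exact isClosed_iInter fun j => isClosed_iInter fun _ =>
      isClosed_eq (by fun_prop) continuous_const
  · exact isClosed_iInter fun j => isClosed_le continuous_const (by fun_prop)

end Assigned

/-! ### Existence and compactness of equilibria -/

section Existence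

variable {I J : Type*} [Finite I] [Finite J] {u : I → J → ℝ → ℝ}

theorem exists_price_bound (hu : ∀ i j, IsUtility (u i j)) :
    ∃ M, 0 ≤ M ∧ ∀ i j, u i j M ≤ 0 := by
  choose x hx using fun i j => (hu i j).exists_nonpos
  obtain ⟨M, hM⟩ := (Set.finite_range fun a : I × J => x a.1 a.2).bddAbove
  refine ⟨max M 0, le_max_right _ _, fun i j => ?_⟩
  exact ((hu i j).strictAnti.antitone ((hM ⟨(i, j), rfl⟩).trans (le_max_left _ _))).trans (hx i j)

/-- The ascending auction with price increment `ε` ends with an approximate equilibrium. -/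
theorem exists_approxSupports (hu : ∀ i j, IsUtility (u i j)) {ε : ℝ} (hε : 0 < ε) :
    ∃ p μ, ApproxSupports u ε p μ := by
  classical
  have := Fintype.ofFinite J
  obtain ⟨M, hM, hMu⟩ := exists_price_bound hu
  -- The invariants of the auction, with price levels in multiples of `ε`. They ask nothing of
  -- unmatched buyers; a state of maximal total price level will satisfy those too.
  let state : (J → ℕ) → (I → Option J) → Prop := fun n μ =>
    IsMatching μ ∧ (∀ j, (∀ i, μ i ≠ some j) → n j = 0) ∧
    ∀ i j, μ i = some j → 0 ≤ u i j (ε * n j) ∧ ∀ k, u i k (ε * n k + ε) ≤ u i j (ε * n j)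
  let sums : Set ℕ := {s | ∃ n μ, state n μ ∧ ∑ j, n j = s}
  have hne : sums.Nonempty :=
    ⟨_, fun _ => 0, fun _ => none, ⟨by simp [IsMatching], by simp, by simp⟩, rfl⟩
  have hbdd : BddAbove sums := by
    refine ⟨∑ _j : J, ⌈M / ε⌉₊, ?_⟩
    rintro s ⟨n, μ, ⟨-, h0, h1⟩, rfl⟩
    refine Finset.sum_le_sum fun j _ => ?_
    by_contra! hlt
    obtain ⟨i, hi⟩ : ∃ i, μ i = some j := by
      by_contra! hn
      have := h0 j hn
      omega
    have h2 : M < ε * n j := by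
      have : M / ε < n j := (Nat.le_ceil _).trans_lt (by exact_mod_cast hlt)
      rwa [div_lt_iff₀' hε] at this
    linarith [(hu i j).strictAnti h2, hMu i j, (h1 i j hi).1]
  obtain ⟨n, μ, ⟨hμ, h0, h1⟩, hs⟩ := Nat.sSup_mem hne hbdd
  -- Otherwise the unmatched buyer takes her best good `k` one increment higher, evicting its owner.
  -- The invariants survive and the total level grows.
  have hnone : ∀ i, μ i = none → ∀ j, u i j (ε * n j + ε) ≤ 0 := by
    intro i hi j
    by_contra! hpos
    have : Nonempty J := ⟨j⟩
    obtain ⟨k, hk⟩ := Finite.exists_max fun k => u i k (ε * n k + ε)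
    have hkpos := hpos.trans_le (hk j)
    let n' : J → ℕ := Function.update n k (n k + 1)
    let μ' : I → Option J := fun a => if a = i then some k else if μ a = some k then none else μ a
    have hle : ∀ l, n l ≤ n' l := fun l => by
      by_cases hl : l = k
      · subst hl; simp [n']
      · simp [n', hl]
    have hanti : ∀ a l, u a l (ε * n' l + ε) ≤ u a l (ε * n l + ε) := fun a l => by
      have : (n l : ℝ) ≤ n' l := by exact_mod_cast hle l
      exact (hu a l).strictAnti.antitone (by gcongr)
    have hk' : ε * (n' k : ℝ) = ε * n k + ε := by simp [n']; ring
    have hst : state n' μ' := by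
      refine ⟨?_, ?_, ?_⟩
      · intro a b l ha hb
        have := hμ a b l
        grind
      · intro l hl
        have hlk : l ≠ k := by
          rintro rfl
          exact hl i (by simp [μ'])
        have : n' l = n l := by simp [n', hlk]
        rw [this]
        refine h0 l fun a ha => hl a ?_
        have hai : a ≠ i := by
          rintro rfl
          simp [hi] at ha
        simp [μ', hai, ha, hlk]
      · intro a l hal
        by_cases hai : a = i
        · subst hai
          obtain rfl : k = l := by simpa [μ'] using hal
          rw [hk']
          exact ⟨hkpos.le, fun m => (hanti _ _).trans (hk m)⟩
        · have hal' : μ a = some l ∧ l ≠ k := by grind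
          have : n' l = n l := by simp [n', hal'.2]
          rw [this]
          exact ⟨(h1 a l hal'.1).1, fun m => (hanti _ _).trans ((h1 a l hal'.1).2 m)⟩
    have h3 : ∑ j, n' j ≤ ∑ j, n j := by
      rw [hs]
      exact le_csSup hbdd ⟨n', μ', hst, rfl⟩
    have h4 : ∑ j, n j < ∑ j, n' j :=
      Finset.sum_lt_sum (fun l _ => hle l) ⟨k, Finset.mem_univ _, by simp [n']⟩
    omega
  refine ⟨fun j => ε * n j, μ, hμ, fun i j => ?_, fun i => ?_, fun j hj => ?_, fun j => ?_⟩
  · cases hi : μ i with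
    | none => rw [assignedPayoff_none hi]; exact hnone i hi j
    | some k => rw [assignedPayoff_some hi]; exact (h1 i k hi).2 j
  · cases hi : μ i with
    | none => rw [assignedPayoff_none hi]
    | some k => rw [assignedPayoff_some hi]; exact (h1 i k hi).1
  · simp [h0 j hj]
  · positivity

theorem isCompact_approxSupports (hu : ∀ i j, IsUtility (u i j)) :
    IsCompact {x : ℝ × (J → ℝ) | x.1 ∈ Set.Icc (0 : ℝ) 1 ∧ ∃ μ, ApproxSupports u x.1 x.2 μ} := by
  obtain ⟨M, hM, hMu⟩ := exists_price_bound hu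
  have hK : IsCompact (Set.Icc (0 : ℝ) 1 ×ˢ Set.Icc (0 : J → ℝ) fun _ => M) :=
    isCompact_Icc.prod isCompact_Icc
  refine hK.of_isClosed_subset ?_ ?_
  · have : {x : ℝ × (J → ℝ) | ∃ μ, ApproxSupports u x.1 x.2 μ} =
        ⋃ μ, {x | ApproxSupports u x.1 x.2 μ} := by
      ext; simp
    refine (isClosed_Icc.preimage continuous_fst).inter ?_
    change IsClosed {x : ℝ × (J → ℝ) | ∃ μ, ApproxSupports u x.1 x.2 μ}
    rw [this]
    exact isClosed_iUnion_of_finite fun μ => isClosed_approxSupports hu μ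
  · rintro x ⟨hx, μ, h⟩
    exact ⟨hx, h.price_nonneg, h.le_of_nonpos hu hM hMu⟩

/-- The errors in [0, 1] admitting an approximate equilibrium form a projection of a compact set,
hence a closed set. It contains every 1/(n+1), so it contains 0. -/
theorem exists_isCompetitiveEquilibrium (hu : ∀ i j, IsUtility (u i j)) :
    ∃ p U, IsCompetitiveEquilibrium u p U := by
  have hcl := ((isCompact_approxSupports hu).image continuous_fst).isClosed
  have hlim : Filter.Tendsto (fun n : ℕ => 1 / ((n : ℝ) + 1)) Filter.atTop (nhds 0) :=
    tendsto_one_div_add_atTop_nhds_zero_nat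
  obtain ⟨⟨ε, p⟩, ⟨-, h⟩, rfl⟩ := hcl.mem_of_tendsto hlim <| Filter.Eventually.of_forall fun n => by
    have hn : (0 : ℝ) < 1 / (n + 1) := by positivity
    obtain ⟨p, μ, h⟩ := exists_approxSupports hu hn
    refine ⟨(_, p), ⟨⟨hn.le, ?_⟩, μ, h⟩, rfl⟩
    rw [div_le_one (by positivity)]
    linarith [n.cast_nonneg (α := ℝ)]
  exact ⟨p, exists_isCompetitiveEquilibrium_iff.2 h⟩

theorem isCompact_equilibriumPrices (hu : ∀ i j, IsUtility (u i j)) :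
    IsCompact {p | ∃ U, IsCompetitiveEquilibrium u p U} := by
  convert ((isCompact_approxSupports hu).inter_right
    (isClosed_singleton.preimage continuous_fst : IsClosed (Prod.fst ⁻¹' {(0 : ℝ)}))).image
    continuous_snd using 1
  ext p
  rw [Set.mem_ofPred_eq, exists_isCompetitiveEquilibrium_iff]
  constructor
  · exact fun h => ⟨(0, p), ⟨⟨⟨le_rfl, zero_le_one⟩, h⟩, rfl⟩, rfl⟩
  · rintro ⟨⟨ε, q⟩, ⟨⟨-, h⟩, rfl⟩, rfl⟩
    exact h

end Existence

/-! ### Minimum of two equilibria and the lowest equilibrium -/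

section Lattice

variable {I J : Type*} {u : I → J → ℝ → ℝ}

/-- Counting: |Z| ≤ |f(G)| ≤ |G| = |g(G)| ≤ |Z|. It serves to show that two matchings give a group
of buyers the same set of goods. -/
theorem Finset.image_eq_of_subset_image {α β : Type*} [DecidableEq β] {G : Finset α} {Z : Finset β}
    {f g : α → β} (hg : Set.InjOn g G) (hgZ : G.image g ⊆ Z) (hZf : Z ⊆ G.image f) :
    G.image f = Z ∧ G.image g = Z := by
  have h1 := Finset.card_image_of_injOn hg
  have h2 := Finset.card_le_card hgZ
  have h3 := Finset.card_le_card hZf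
  have h4 := Finset.card_image_le (s := G) (f := f)
  exact ⟨(Finset.eq_of_subset_of_card_le hZf (by omega)).symm,
    Finset.eq_of_subset_of_card_le hgZ (by omega)⟩

theorem IsMatching.injOn {μ : I → Option J} (h : IsMatching μ) {G : Set I}
    (hG : ∀ i ∈ G, ∃ j, μ i = some j) : Set.InjOn μ G := by
  intro a ha b _ hab
  obtain ⟨j, hj⟩ := hG a ha
  exact h a b j hj (hab ▸ hj)

/-- Merging an equilibrium with prices `r`: if exactly the buyers in `G` gain from `r`, and the
matching `ν` gives them goods for which `r` is the lower price, then the lower ones of both prices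
form an equilibrium. -/
theorem Supports.merge [Finite J] (hu : ∀ i j, IsUtility (u i j)) {p r : J → ℝ} {U R : I → ℝ}
    {μ ν : I → Option J} (hs : Supports u p U μ) (hν : IsMatching ν) (hr : ∀ j, 0 ≤ r j)
    (G : Finset I)
    (hG : ∀ i ∈ G, U i < R i ∧ (∃ j, ν i = some j ∧ u i j (r j) = R i) ∧ ∀ j, u i j (r j) ≤ R i)
    (hG' : ∀ i, i ∉ G → ∀ j, u i j (r j) ≤ U i) :
    ∃ V, IsCompetitiveEquilibrium u (fun j => min (p j) (r j)) V := by
  classical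
  have := Fintype.ofFinite J
  -- At prices `p` no good yields more than `U i`, so a good yielding more at `r` must be cheaper
  -- there.
  have hlow : ∀ i ∈ G, ∃ j, ν i = some j ∧ u i j (r j) = R i ∧ r j < p j := by
    intro i hi
    obtain ⟨hlt, ⟨j, hj, hjR⟩, -⟩ := hG i hi
    refine ⟨j, hj, hjR, ?_⟩
    rw [← (hu i j).strictAnti.lt_iff_gt]
    linarith [hs.payoff_ge i j]
  -- A good with `r j < p j` has a positive price, so `μ` sells it; its owner would gain at `r` and
  -- hence lies in `G`. By counting, both `μ` and `ν` give `G` exactly the goods that are cheaper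
  -- under `r`, so `ν` on `G` and `μ` elsewhere can be spliced.
  obtain ⟨h1, h2⟩ := Finset.image_eq_of_subset_image (G := G) (f := μ) (g := ν)
    (Z := (Finset.univ.filter fun j => r j < p j).image some)
    (hν.injOn fun i hi => (hG i hi).2.1.imp fun _ h => h.1)
    (by
      intro o ho
      obtain ⟨i, hi, rfl⟩ := Finset.mem_image.1 ho
      obtain ⟨j, hj, -, hlt⟩ := hlow i hi
      simp [hj, hlt])
    (by
      intro o ho
      obtain ⟨j, hj, rfl⟩ := Finset.mem_image.1 ho
      have hlt : r j < p j := by simpa using hj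
      obtain ⟨i, hi⟩ := hs.exists_matched ((hr j).trans_lt hlt)
      refine Finset.mem_image.2 ⟨i, ?_, hi⟩
      by_contra hiG
      linarith [hG' i hiG j, (hu i j).strictAnti hlt, hs.payoff_eq i j hi])
  have hμG : ∀ i j, μ i = some j → (i ∈ G ↔ r j < p j) := by
    intro i j hij
    constructor
    · intro hi
      have : some j ∈ G.image μ := Finset.mem_image.2 ⟨i, hi, hij⟩
      rw [h1] at this
      simpa using this
    · intro hlt
      have : some j ∈ G.image μ := by
        rw [h1]
        simpa using hlt
      obtain ⟨i', hi', hij'⟩ := Finset.mem_image.1 this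
      rwa [hs.isMatching i i' j hij hij']
  refine ⟨fun i => if i ∈ G then R i else U i, fun i => if i ∈ G then ν i else μ i,
    ?_, ?_, ?_, ?_, ?_, ?_, ?_⟩
  · have key : ∀ a b j, a ∈ G → b ∉ G → ν a = some j → μ b = some j → False := by
      intro a b j ha hb haj hbj
      obtain ⟨k, hk, -, hlt⟩ := hlow a ha
      obtain rfl : k = j := by simpa [haj] using hk.symm
      exact hb ((hμG b k hbj).2 hlt)
    intro a b j ha hb
    by_cases haG : a ∈ G <;> by_cases hbG : b ∈ G <;> simp only [haG, hbG, if_true, if_false] at ha hb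
    · exact hν a b j ha hb
    · exact (key a b j haG hbG ha hb).elim
    · exact (key b a j hbG haG hb ha).elim
    · exact hs.isMatching a b j ha hb
  · intro i j hij
    by_cases hi : i ∈ G <;> simp only [hi, if_true, if_false] at hij ⊢
    · obtain ⟨k, hk, hkR, hlt⟩ := hlow i hi
      obtain rfl : k = j := by simpa [hij] using hk.symm
      rw [min_eq_right hlt.le, hkR]
    · rw [min_eq_left (not_lt.1 fun h => hi ((hμG i j hij).2 h)), hs.payoff_eq i j hij]
  · intro i j
    by_cases hi : i ∈ G <;> simp only [hi, if_true, if_false] <;>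
      rcases min_choice (p j) (r j) with h | h <;> rw [h]
    · exact (hs.payoff_ge i j).trans (hG i hi).1.le
    · exact (hG i hi).2.2 j
    · exact hs.payoff_ge i j
    · exact hG' i hi j
  · intro i h
    by_cases hi : i ∈ G <;> simp only [hi, if_true, if_false] at h ⊢
    · obtain ⟨k, hk, -⟩ := hlow i hi
      simp [h] at hk
    · exact hs.payoff_unmatched i h
  · intro j hj
    have hle : p j ≤ r j := by
      by_contra! hlt
      have : some j ∈ G.image ν := by
        rw [h2]
        simpa using hlt
      obtain ⟨i, hi, hij⟩ := Finset.mem_image.1 this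
      exact hj i (by simpa [hi] using hij)
    rw [min_eq_left hle]
    refine hs.price_unmatched j fun i hij => hj i ?_
    have hi : i ∉ G := fun h => hle.not_gt ((hμG i j hij).1 h)
    simpa [hi] using hij
  · intro i
    split_ifs with hi
    · exact (hs.payoff_nonneg i).trans (hG i hi).1.le
    · exact hs.payoff_nonneg i
  · exact fun j => le_min (hs.price_nonneg j) (hr j)

theorem IsCompetitiveEquilibrium.exists_min [Finite I] [Finite J] (hu : ∀ i j, IsUtility (u i j))
    {p q : J → ℝ} {U V : I → ℝ} (hp : IsCompetitiveEquilibrium u p U)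
    (hq : IsCompetitiveEquilibrium u q V) :
    ∃ W, IsCompetitiveEquilibrium u (fun j => min (p j) (q j)) W := by
  classical
  have := Fintype.ofFinite I
  obtain ⟨μ, hμ⟩ := hp
  obtain ⟨ν, hν⟩ := hq
  refine hμ.merge hu hν.isMatching hν.price_nonneg (Finset.univ.filter fun i => U i < V i) (R := V)
    (fun i hi => ?_) (fun i hi j => ?_)
  · have hlt : U i < V i := by simpa using hi
    obtain ⟨j, hj⟩ := hν.matched_of_pos ((hμ.payoff_nonneg i).trans_lt hlt)
    exact ⟨hlt, ⟨j, hj, (hν.payoff_eq i j hj).symm⟩, hν.payoff_ge i⟩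
  · exact (hν.payoff_ge i j).trans (by simpa using hi)

theorem IsCompetitiveEquilibrium.payoff_anti (hu : ∀ i j, IsUtility (u i j))
    {p q : J → ℝ} {U V : I → ℝ} (hp : IsCompetitiveEquilibrium u p U)
    (hq : IsCompetitiveEquilibrium u q V) (hpq : p ≤ q) : V ≤ U := by
  obtain ⟨μ, hμ⟩ := hp
  obtain ⟨ν, hν⟩ := hq
  intro i
  cases hi : ν i with
  | none =>
    rw [hν.payoff_unmatched i hi]
    exact hμ.payoff_nonneg i
  | some j =>
    rw [hν.payoff_eq i j hi]
    exact ((hu i j).strictAnti.antitone (hpq j)).trans (hμ.payoff_ge i j)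

theorem exists_isLowestEquilibrium [Finite I] [Finite J] (hu : ∀ i j, IsUtility (u i j)) :
    ∃ p U, IsLowestEquilibrium u p U := by
  have := Fintype.ofFinite J
  obtain ⟨p, ⟨U, hp⟩, hmin⟩ := (isCompact_equilibriumPrices hu).exists_isMinOn
    (exists_isCompetitiveEquilibrium hu)
    (f := fun p => ∑ j, p j) (by fun_prop)
  refine ⟨p, U, hp, fun q V hq => ?_⟩
  have hpq : p ≤ q := by
    by_contra hn
    obtain ⟨j, hj⟩ : ∃ j, q j < p j := by simpa [Pi.le_def] using hn
    have h1 : ∑ j, p j ≤ ∑ j, min (p j) (q j) := hmin (hp.exists_min hu hq)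
    exact h1.not_gt (Finset.sum_lt_sum (fun _ _ => min_le_left _ _)
      ⟨j, Finset.mem_univ _, min_lt_of_right_lt hj⟩)
  exact ⟨hpq, hp.payoff_anti hu hq hpq⟩

theorem IsLowestEquilibrium.unique {p q : J → ℝ} {U V : I → ℝ}
    (hp : IsLowestEquilibrium u p U) (hq : IsLowestEquilibrium u q V) : p = q ∧ U = V :=
  ⟨le_antisymm (hp.2 q V hq.1).1 (hq.2 p U hp.1).1, le_antisymm (hq.2 p U hp.1).2 (hp.2 q V hq.1).2⟩

end Lattice

/-! ### Submarkets with reserve prices and coalitions -/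

section Submarket

variable {I J : Type*} {u : I → J → ℝ → ℝ}

open Classical in
/-- The market of the buyers in `M` and the goods in `T`, with prices counted from the reserve
prices `f` and payoffs counted from the outside options `o`; no other trade is profitable. -/
noncomputable def submarket (u : I → J → ℝ → ℝ) (M : Finset I) (T : Finset J) (f : J → ℝ)
    (o : I → ℝ) : I → J → ℝ → ℝ :=
  fun i j x => if i ∈ M ∧ j ∈ T then u i j (f j + x) - o i else -1 - x

variable {M N : Finset I} {T : Finset J} {f x : J → ℝ} {o W : I → ℝ} {ν : I → Option J}

theorem isUtility_submarket (hu : ∀ i j, IsUtility (u i j)) (ho : ∀ i ∈ M, 0 ≤ o i) (i : I)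
    (j : J) : IsUtility (submarket u M T f o i j) := by
  by_cases h : i ∈ M ∧ j ∈ T
  · have heq : submarket u M T f o i j = fun x => u i j (f j + x) - o i := by
      funext x
      simp [submarket, h]
    rw [heq]
    obtain ⟨hc, ha, x, hx⟩ := hu i j
    refine ⟨by fun_prop, fun a b hab => ?_, x - f j, ?_⟩
    · exact sub_lt_sub_right (ha (by linarith)) _
    · rw [add_sub_cancel]
      linarith [ho i h.1]
  · have heq : submarket u M T f o i j = fun x => -1 - x := by
      funext x
      simp only [submarket, h, if_false]
    rw [heq]
    exact ⟨by fun_prop, fun a b hab => by linarith, 0, by norm_num⟩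

/-- Outside `M` and `T` the payoff `-1 - x` is negative at every non-negative price, so no such pair
is matched. -/
theorem Supports.submarket_matched (h : Supports (submarket u M T f o) x W ν) {i : I} {j : J}
    (hij : ν i = some j) : i ∈ M ∧ j ∈ T ∧ W i + o i = u i j (f j + x j) := by
  have h1 := h.payoff_eq i j hij
  have h2 := h.payoff_nonneg i
  have h3 := h.price_nonneg j
  by_cases hc : i ∈ M ∧ j ∈ T
  · refine ⟨hc.1, hc.2, ?_⟩
    simp only [submarket, hc, and_self, if_true] at h1
    linarith
  · simp only [submarket, hc, if_false] at h1
    linarith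

theorem Supports.submarket_ge (h : Supports (submarket u M T f o) x W ν) {i : I} {j : J}
    (hi : i ∈ M) (hj : j ∈ T) : u i j (f j + x j) ≤ W i + o i := by
  have h1 := h.payoff_ge i j
  simp only [submarket, hi, hj, and_self, if_true] at h1
  linarith

open Classical in
/-- An equilibrium of a submarket whose reserve prices keep the other buyers away can be merged
into an equilibrium of the whole market. -/
theorem Supports.merge_submarket [Finite J] (hu : ∀ i j, IsUtility (u i j)) {p : J → ℝ} {U : I → ℝ}
    {μ : I → Option J} (hs : Supports u p U μ) (hf : ∀ j ∈ T, 0 ≤ f j)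
    (h : Supports (submarket u M T f o) x W ν)
    (hM : ∀ i, i ∉ M → ∀ j ∈ T, u i j (f j + x j) ≤ U i)
    (hnone : ∀ i ∈ M, ν i = none → o i = U i) :
    ∃ V, IsCompetitiveEquilibrium u
      (fun j => min (p j) (if j ∈ T then f j + x j else p j)) V := by
  refine hs.merge hu h.isMatching (fun j => ?_) (M.filter fun i => U i < W i + o i)
    (R := fun i => W i + o i) (fun i hi => ?_) (fun i hi j => ?_)
  · split_ifs with hj
    · exact add_nonneg (hf j hj) (h.price_nonneg j)
    · exact hs.price_nonneg j
  · obtain ⟨hiM, hlt⟩ := Finset.mem_filter.1 hi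
    refine ⟨hlt, ?_, fun j => ?_⟩
    · cases hν : ν i with
      | none => linarith [h.payoff_unmatched i hν, hnone i hiM hν]
      | some j =>
        obtain ⟨-, hj, heq⟩ := h.submarket_matched hν
        exact ⟨j, rfl, by simp only [hj, if_true, heq]⟩
    · split_ifs with hj
      · exact h.submarket_ge hiM hj
      · exact (hs.payoff_ge i j).trans hlt.le
  · split_ifs with hj
    · by_cases hiM : i ∈ M
      · have : W i + o i ≤ U i := by simpa [hiM] using hi
        exact (h.submarket_ge hiM hj).trans this
      · exact hM i hiM j hj
    · exact hs.payoff_ge i j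

/-- If, at equilibrium prices `p`, the goods assigned to the buyers in `N` have reserve prices `f`
below `p` at which no other buyer gains, then some equilibrium has a lower price for some good. -/
theorem Supports.exists_lower [Finite I] [Finite J] (hu : ∀ i j, IsUtility (u i j)) {p : J → ℝ}
    {U : I → ℝ} {μ : I → Option J} (hs : Supports u p U μ) (hN : N.Nonempty)
    (hμN : ∀ i ∈ N, ∃ j ∈ T, μ i = some j)
    (hf : ∀ j ∈ T, 0 ≤ f j) (hfp : ∀ j ∈ T, f j < p j)
    (hout : ∀ i, i ∉ N → ∀ j ∈ T, u i j (f j) ≤ U i) :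
    ∃ q V, IsCompetitiveEquilibrium u q V ∧ ∃ j, q j < p j := by
  classical
  obtain ⟨i₀, hi₀⟩ := hN
  have hTne : T.Nonempty := (hμN i₀ hi₀).imp fun _ h => h.1
  have hcard : N.card ≤ T.card := by
    have hinj : Set.InjOn μ N := hs.isMatching.injOn fun i hi => (hμN i hi).imp fun _ h => h.2
    rw [← Finset.card_image_of_injOn hinj, ← Finset.card_image_of_injective T (Option.some_injective J)]
    refine Finset.card_le_card fun a ha => ?_
    obtain ⟨i, hi, rfl⟩ := Finset.mem_image.1 ha
    obtain ⟨j, hj, hij⟩ := hμN i hi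
    rw [hij]
    exact Finset.mem_image_of_mem _ hj
  -- the best payoff of `i₀` from goods in `T` at prices `f + x`
  let b : (J → ℝ) → ℝ := fun x => T.sup' hTne fun j => u i₀ j (f j + x j)
  have hb : Continuous b := by
    refine Continuous.finset_sup'_apply hTne fun j _ => ?_
    exact (hu i₀ j).continuous.comp (by fun_prop)
  have hsub : ∀ i j, IsUtility (submarket u (N.erase i₀) T f U i j) :=
    isUtility_submarket hu fun i _ => hs.payoff_nonneg i
  -- Without `i₀` there are fewer buyers than goods in `T`. Among the equilibria of this submarket,
  -- one least attractive to `i₀` is chosen.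
  obtain ⟨x, ⟨W, ν, hν⟩, hmin⟩ := (isCompact_equilibriumPrices hsub).exists_isMinOn
    (exists_isCompetitiveEquilibrium hsub) hb.continuousOn
  have hgain : ∀ (x : J → ℝ) (j : J), j ∈ T → f j + x j < p j →
      min (p j) (if j ∈ T then f j + x j else p j) < p j := by
    intro x j hj hlt
    simp only [hj, if_true]
    exact min_lt_of_right_lt hlt
  have hout' : ∀ y : J → ℝ, (∀ j, 0 ≤ y j) → ∀ i, i ∉ N → ∀ j ∈ T, u i j (f j + y j) ≤ U i :=
    fun y hy i hi j hj => ((hu i j).strictAnti.antitone (by linarith [hy j])).trans (hout i hi j hj)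
  by_cases hle : b x ≤ U i₀
  · obtain ⟨V, hV⟩ := hs.merge_submarket hu hf hν (fun i hi j hj => by
      by_cases h : i = i₀
      · subst h
        exact (Finset.le_sup' (fun j => u i j (f j + x j)) hj).trans hle
      · exact hout' x hν.price_nonneg i (fun hN => hi (Finset.mem_erase.2 ⟨h, hN⟩)) j hj)
      (fun _ _ _ => rfl)
    refine ⟨_, V, hV, ?_⟩
    -- Some good of `T` stays unsold, at its reserve price `f j < p j`.
    obtain ⟨j, hj, hfree⟩ : ∃ j ∈ T, ∀ i, ν i ≠ some j := by
      by_contra! hall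
      have hsubset : T.image some ⊆ (N.erase i₀).image ν := by
        intro a ha
        obtain ⟨j, hj, rfl⟩ := Finset.mem_image.1 ha
        obtain ⟨i, hi⟩ := hall j hj
        exact Finset.mem_image.2 ⟨i, (hν.submarket_matched hi).1, hi⟩
      have h1 := (Finset.card_le_card hsubset).trans Finset.card_image_le
      rw [Finset.card_image_of_injective T (Option.some_injective J)] at h1
      have h2 := Finset.card_erase_lt_of_mem hi₀
      omega
    exact ⟨j, hgain x j hj (by simpa [hν.price_unmatched j hfree] using hfp j hj)⟩
  · push Not at hle
    -- `i₀` now rejoins with an outside option strictly between `U i₀` and `b x`.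
    let o : I → ℝ := Function.update U i₀ ((b x + U i₀) / 2)
    have ho₀ : o i₀ = (b x + U i₀) / 2 := by simp [o]
    have ho : ∀ i, i ≠ i₀ → o i = U i := fun i hi => by simp [o, hi]
    have ho_nonneg : ∀ i ∈ N, 0 ≤ o i := fun i _ => by
      by_cases h : i = i₀
      · subst h
        linarith [hs.payoff_nonneg i]
      · rw [ho i h]
        exact hs.payoff_nonneg i
    obtain ⟨y, Y, κ, hκ⟩ := exists_isCompetitiveEquilibrium
      (isUtility_submarket (T := T) (f := f) hu ho_nonneg)
    cases hκi : κ i₀ with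
    | none =>
      have hY := hκ.payoff_unmatched i₀ hκi
      -- If `i₀` prefers her outside option, the equilibrium survives her removal, but then `b y ≤ o
      -- i₀ < b x` contradicts the choice of `x`.
      have hmem : ∃ V, IsCompetitiveEquilibrium (submarket u (N.erase i₀) T f U) y V := by
        have hκne : ∀ i j, κ i = some j → i ≠ i₀ := by
          rintro i j hij rfl
          simp [hκi] at hij
        refine ⟨Y, κ, hκ.isMatching, fun i j hij => ?_, fun i j => ?_, hκ.payoff_unmatched,
          hκ.price_unmatched, hκ.payoff_nonneg, hκ.price_nonneg⟩
        · obtain ⟨hi, hj, heq⟩ := hκ.submarket_matched hij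
          have hne := hκne i j hij
          simp only [submarket, Finset.mem_erase, hi, hj, hne, ne_eq, not_false_eq_true, and_self,
            if_true]
          linarith [ho i hne]
        · by_cases hc : i ∈ N.erase i₀ ∧ j ∈ T
          · simp only [submarket, hc, and_self, if_true]
            obtain ⟨hne, hi⟩ := Finset.mem_erase.1 hc.1
            linarith [hκ.submarket_ge hi hc.2, ho i hne]
          · simp only [submarket, hc, if_false]
            linarith [hκ.payoff_nonneg i, hκ.price_nonneg j]
      have h1 : b x ≤ b y := hmin hmem
      have h2 : b y ≤ o i₀ := Finset.sup'_le _ _ fun j hj => by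
        linarith [hκ.submarket_ge hi₀ hj]
      linarith
    | some j =>
      obtain ⟨-, hj, heq⟩ := hκ.submarket_matched hκi
      obtain ⟨V, hV⟩ := hs.merge_submarket hu hf hκ
        (fun i hi => hout' y hκ.price_nonneg i hi)
        (fun i _ hi => ho i (by rintro rfl; simp [hκi] at hi))
      -- A matched `i₀` gets at least `o i₀ > U i₀`, so her good costs less than under `p`.
      refine ⟨_, V, hV, j, hgain y j hj ?_⟩
      rw [← (hu i₀ j).strictAnti.lt_iff_gt]
      linarith [hs.payoff_ge i₀ j, hκ.payoff_nonneg i₀]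

/-- No coalition of buyers can misreport its utilities so that, in some equilibrium for the
reported utilities, all its members are better off than in the lowest equilibrium. -/
theorem IsLowestEquilibrium.exists_assignedPayoff_le [Finite I] [Finite J] {u' : I → J → ℝ → ℝ}
    (hu : ∀ i j, IsUtility (u i j)) {S : Finset I} (hS : S.Nonempty)
    (hu' : ∀ i, i ∉ S → u' i = u i) {p q : J → ℝ} {U V : I → ℝ}
    (hp : IsLowestEquilibrium u p U) (hq : Supports u' q V ν) :
    ∃ i ∈ S, assignedPayoff u ν q i ≤ U i := by
  classical
  have := Fintype.ofFinite I
  by_contra! hgain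
  obtain ⟨μ, hμ⟩ := hp.1
  let N : Finset I := Finset.univ.filter fun i => U i < assignedPayoff u ν q i
  have hN : ∀ i, i ∈ N ↔ U i < assignedPayoff u ν q i := by simp [N]
  -- A buyer outside `N` is outside `S`, so her report is true: what she gets under `ν` is her best
  -- at `q`, and it does not exceed `U i`.
  have hout : ∀ i, i ∉ N → ∀ j, u i j (q j) ≤ U i := by
    intro i hi j
    have hiS : i ∉ S := fun h => hi ((hN i).2 (hgain i h))
    have h1 := hq.payoff_ge i j
    rw [hq.eq_assignedPayoff i] at h1
    simp only [assignedPayoff, hu' i hiS] at h1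
    exact h1.trans (not_lt.1 (mt (hN i).2 hi))
  have hνN : ∀ i ∈ N, ∃ j, ν i = some j ∧ q j < p j := by
    intro i hi
    have hlt := (hN i).1 hi
    cases hν : ν i with
    | none =>
      rw [assignedPayoff_none hν] at hlt
      exact absurd (hμ.payoff_nonneg i) hlt.not_ge
    | some j =>
      refine ⟨j, rfl, ?_⟩
      rw [assignedPayoff_some hν] at hlt
      rw [← (hu i j).strictAnti.lt_iff_gt]
      linarith [hμ.payoff_ge i j]
  -- Each good that `ν` gives to `N` is cheaper under `q`, so its owner under `μ` would gain at `q`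
  -- and also lies in `N`. By counting, `μ` and `ν` give `N` the same goods.
  obtain ⟨h1, -⟩ := Finset.image_eq_of_subset_image (G := N) (f := μ) (g := ν) (Z := N.image ν)
    (hq.isMatching.injOn fun i hi => (hνN i hi).imp fun _ h => h.1) subset_rfl (by
      intro a ha
      obtain ⟨i, hi, rfl⟩ := Finset.mem_image.1 ha
      obtain ⟨j, hj, hlt⟩ := hνN i hi
      obtain ⟨k, hk⟩ := hμ.exists_matched ((hq.price_nonneg j).trans_lt hlt)
      refine Finset.mem_image.2 ⟨k, ?_, hk.trans hj.symm⟩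
      by_contra hkN
      linarith [hout k hkN j, (hu k j).strictAnti hlt, hμ.payoff_eq k j hk])
  have := Fintype.ofFinite J
  let T : Finset J := Finset.univ.filter fun j => some j ∈ N.image ν
  have hT : ∀ j, j ∈ T ↔ some j ∈ N.image ν := by simp [T]
  obtain ⟨r, R, hr, j, hj⟩ := hμ.exists_lower (T := T) (f := q) hu
    (hS.mono fun i hi => (hN i).2 (hgain i hi))
    (fun i hi => by
      have hmem : μ i ∈ N.image ν := h1 ▸ Finset.mem_image_of_mem μ hi
      obtain ⟨k, hk, hki⟩ := Finset.mem_image.1 hmem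
      obtain ⟨j, hj, -⟩ := hνN k hk
      refine ⟨j, (hT j).2 (hj ▸ Finset.mem_image_of_mem ν hk), hki ▸ hj⟩)
    (fun j _ => hq.price_nonneg j)
    (fun j hj => by
      obtain ⟨k, hk, hkj⟩ := Finset.mem_image.1 ((hT j).1 hj)
      obtain ⟨j', hj', hlt⟩ := hνN k hk
      obtain rfl : j' = j := by simpa [hkj] using hj'.symm
      exact hlt)
    (fun i hi j _ => hout i hi j)
  exact ((hp.2 r R hr).1 j).not_gt hj

end Submarket

open AdAuction

/-! ### Linear programming duality for the assignment problem -/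

section Duality

variable {I J : Type*}

/-- The market of buyers whose payoff is the value `w i j` of the good minus its price. -/
def valueMarket (w : I → J → ℝ) : I → J → ℝ → ℝ := fun i j x => w i j - x

theorem isUtility_valueMarket (w : I → J → ℝ) (i : I) (j : J) :
    IsUtility (valueMarket w i j) :=
  ⟨by unfold valueMarket; fun_prop, fun a b hab => by simp only [valueMarket]; linarith, w i j,
    by simp [valueMarket]⟩

theorem assignedValue_none {w : I → J → ℝ} {σ : I → Option J} {i : I} (h : σ i = none) :
    assignedValue w σ i = 0 := by
  simp [assignedValue, h]

theorem assignedValue_some {w : I → J → ℝ} {σ : I → Option J} {i : I} {j : J}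
    (h : σ i = some j) : assignedValue w σ i = w i j := by
  simp [assignedValue, h]

open Classical in
theorem sum_assigned_eq_sum_ite [Fintype I] [Fintype J] (p : J → ℝ) {σ : I → Option J}
    (hσ : IsMatching σ) :
    ∑ i, (σ i).elim 0 p = ∑ j, if ∃ i, σ i = some j then p j else 0 := by
  have h1 : ∀ i, (σ i).elim 0 p = ∑ j, if σ i = some j then p j else 0 := by
    intro i
    cases σ i <;> simp
  simp_rw [h1]
  rw [Finset.sum_comm]
  refine Finset.sum_congr rfl fun j _ => ?_
  by_cases h : ∃ i, σ i = some j
  · obtain ⟨i, hi⟩ := h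
    rw [Finset.sum_eq_single i, if_pos hi, if_pos ⟨i, hi⟩]
    · exact fun k _ hk => if_neg fun hkj => hk (hσ k i j hkj hi)
    · simp
  · rw [if_neg h]
    push Not at h
    simp [h]

theorem sum_assigned_le [Fintype I] [Fintype J] {p : J → ℝ} (hp : ∀ j, 0 ≤ p j)
    {σ : I → Option J} (hσ : IsMatching σ) : ∑ i, (σ i).elim 0 p ≤ ∑ j, p j := by
  classical
  rw [sum_assigned_eq_sum_ite p hσ]
  refine Finset.sum_le_sum fun j _ => ?_
  split_ifs
  exacts [le_rfl, hp j]

theorem sum_assigned_eq [Fintype I] [Fintype J] {p : J → ℝ} {σ : I → Option J}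
    (hσ : IsMatching σ) (h0 : ∀ j, (∀ i, σ i ≠ some j) → p j = 0) :
    ∑ i, (σ i).elim 0 p = ∑ j, p j := by
  classical
  rw [sum_assigned_eq_sum_ite p hσ]
  refine Finset.sum_congr rfl fun j _ => ?_
  split_ifs with h
  · rfl
  · exact (h0 j (by simpa using h)).symm

variable {w : I → J → ℝ} {p : J → ℝ} {U : I → ℝ} {μ σ : I → Option J}

theorem Supports.assignedValue_eq (h : Supports (valueMarket w) p U μ) (i : I) :
    assignedValue w μ i = U i + (μ i).elim 0 p := by
  cases hi : μ i with
  | none => simp [assignedValue, hi, h.payoff_unmatched i hi]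
  | some j => simp [assignedValue, hi, h.payoff_eq i j hi, valueMarket]

theorem assignedValue_le (hU : ∀ i, 0 ≤ U i) (hw : ∀ i j, w i j ≤ U i + p j) (i : I) :
    assignedValue w σ i ≤ U i + (σ i).elim 0 p := by
  cases hi : σ i with
  | none => simp [assignedValue, hi, hU i]
  | some j => simpa [assignedValue, hi] using hw i j

theorem Supports.value_le (h : Supports (valueMarket w) p U μ) (i : I) (j : J) :
    w i j ≤ U i + p j := by
  have := h.payoff_ge i j
  simp only [valueMarket] at this
  linarith

variable [Fintype I] [Fintype J]

theorem Supports.sum_assignedValue (h : Supports (valueMarket w) p U μ) :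
    ∑ i, assignedValue w μ i = ∑ i, U i + ∑ j, p j := by
  rw [← sum_assigned_eq h.isMatching h.price_unmatched, ← Finset.sum_add_distrib]
  exact Finset.sum_congr rfl fun i _ => h.assignedValue_eq i

theorem sum_assignedValue_le (hU : ∀ i, 0 ≤ U i) (hp : ∀ j, 0 ≤ p j)
    (hw : ∀ i j, w i j ≤ U i + p j) (hσ : IsMatching σ) (s : Finset I) :
    ∑ i ∈ s, assignedValue w σ i ≤ ∑ i ∈ s, U i + ∑ j, p j := by
  have h1 : ∑ i ∈ s, (σ i).elim 0 p ≤ ∑ i, (σ i).elim 0 p :=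
    Finset.sum_le_sum_of_subset_of_nonneg (Finset.subset_univ s) fun i _ _ => by
      cases σ i <;> simp [hp]
  calc ∑ i ∈ s, assignedValue w σ i ≤ ∑ i ∈ s, (U i + (σ i).elim 0 p) :=
        Finset.sum_le_sum fun i _ => assignedValue_le hU hw i
    _ = ∑ i ∈ s, U i + ∑ i ∈ s, (σ i).elim 0 p := Finset.sum_add_distrib
    _ ≤ _ := by linarith [sum_assigned_le hp hσ]

theorem Supports.isOptimal (h : Supports (valueMarket w) p U μ) (hσ : IsMatching σ) :
    ∑ i, assignedValue w σ i ≤ ∑ i, assignedValue w μ i := by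
  rw [h.sum_assignedValue]
  exact sum_assignedValue_le h.payoff_nonneg h.price_nonneg h.value_le hσ Finset.univ

/-- Complementary slackness. -/
theorem supports_of_sum_le (hU : ∀ i, 0 ≤ U i) (hp : ∀ j, 0 ≤ p j)
    (hw : ∀ i j, w i j ≤ U i + p j) (hσ : IsMatching σ)
    (hsum : ∑ i, U i + ∑ j, p j ≤ ∑ i, assignedValue w σ i) :
    Supports (valueMarket w) p U σ := by
  classical
  have hle : ∀ i ∈ Finset.univ, assignedValue w σ i ≤ U i + (σ i).elim 0 p :=
    fun i _ => assignedValue_le hU hw i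
  have h1 := Finset.sum_le_sum hle
  rw [Finset.sum_add_distrib] at h1
  have h2 := sum_assigned_le hp hσ
  have heq : ∀ i, assignedValue w σ i = U i + (σ i).elim 0 p := by
    have := (Finset.sum_eq_sum_iff_of_le hle).1 (by
      rw [Finset.sum_add_distrib]
      linarith)
    exact fun i => this i (Finset.mem_univ i)
  refine ⟨hσ, fun i j hij => ?_, fun i j => ?_, fun i hi => ?_, fun j hj => ?_, hU, hp⟩
  · have := heq i
    simp only [assignedValue, hij, Option.elim_some] at this
    simp only [valueMarket]
    linarith
  · simp only [valueMarket]
    linarith [hw i j]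
  · have := heq i
    simpa [assignedValue, hi] using this.symm
  -- Setting the price of an unsold good to 0 leaves the total price of the assigned goods
  -- unchanged. That total already equals the sum of all prices, so the erased price was 0.
  · let p' : J → ℝ := Function.update p j 0
    have hp' : ∀ k, 0 ≤ p' k := fun k => by
      by_cases hk : k = j
      · subst hk; simp [p']
      · simp [p', hk, hp]
    have h3 : ∀ i, (σ i).elim 0 p' = (σ i).elim 0 p := fun i => by
      cases hi : σ i with
      | none => rfl
      | some k =>
        have : k ≠ j := by
          rintro rfl
          exact hj i hi
        simp [p', this]
    have h4 := sum_assigned_le hp' hσ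
    simp_rw [h3] at h4
    have h5 : ∑ k, p' k = ∑ k, p k - p j := by
      rw [Finset.sum_update_of_mem (Finset.mem_univ j), zero_add,
        ← Finset.sum_sdiff (Finset.subset_univ {j})]
      simp
    linarith [hp j]

end Duality

/-! ### Marginal contributions and the lowest equilibrium -/

section Externality

variable {I J : Type*} [Fintype I] [DecidableEq I] {w : I → J → ℝ} {p : J → ℝ} {U : I → ℝ}
  {μ σ : I → Option J}

/-- The largest total value of an assignment to the buyers other than `i`. -/
noncomputable def maxValueWithout (w : I → J → ℝ) (i : I) : ℝ :=
  ⨆ σ : {σ : I → Option J // IsMatching σ}, ∑ k ∈ Finset.univ.erase i, assignedValue w σ.1 k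

theorem le_maxValueWithout [Finite J] (w : I → J → ℝ) (i : I) (hσ : IsMatching σ) :
    ∑ k ∈ Finset.univ.erase i, assignedValue w σ k ≤ maxValueWithout w i :=
  le_ciSup (f := fun σ : {σ : I → Option J // IsMatching σ} =>
    ∑ k ∈ Finset.univ.erase i, assignedValue w σ.1 k) (Set.finite_range _).bddAbove ⟨σ, hσ⟩

theorem exists_maxValueWithout_eq [Finite J] (w : I → J → ℝ) (i : I) :
    ∃ σ : I → Option J, IsMatching σ ∧ σ i = none ∧
      ∑ k, assignedValue w σ k = maxValueWithout w i := by
  have : Nonempty {σ : I → Option J // IsMatching σ} :=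
    ⟨⟨fun _ => none, by simp [IsMatching]⟩⟩
  obtain ⟨⟨σ, hσ⟩, h⟩ := exists_eq_ciSup_of_finite
    (f := fun σ : {σ : I → Option J // IsMatching σ} =>
      ∑ k ∈ Finset.univ.erase i, assignedValue w σ.1 k)
  refine ⟨Function.update σ i none, ?_, by simp, ?_⟩
  · intro a b j ha hb
    by_cases hai : a = i
    · simp [hai] at ha
    · by_cases hbi : b = i
      · simp [hbi] at hb
      · simp only [Function.update_apply, hai, hbi, if_false] at ha hb
        exact hσ a b j ha hb
  · rw [maxValueWithout, ← h, ← Finset.sum_erase_add _ _ (Finset.mem_univ i),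
      assignedValue_none (by simp), add_zero]
    refine Finset.sum_congr rfl fun k hk => ?_
    simp [assignedValue, Finset.ne_of_mem_erase hk]

/-- In the lowest equilibrium, every buyer receives her marginal contribution to the total
value. -/
theorem IsLowestEquilibrium.payoff_eq_sub [Fintype J] (h : IsLowestEquilibrium (valueMarket w) p U)
    (hμ : Supports (valueMarket w) p U μ) (i : I) :
    U i = ∑ k, assignedValue w μ k - maxValueWithout w i := by
  obtain ⟨τ, hτ, hτi, hτsum⟩ := exists_maxValueWithout_eq w i
  set r := ∑ k, assignedValue w μ k - maxValueWithout w i with hr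
  have hr0 : 0 ≤ r := by
    rw [hr, ← hτsum]
    linarith [hμ.isOptimal hτ]
  refine le_antisymm ?_ ?_
  -- Upper bound: the equilibrium without the payoff of `i` is dual feasible for the other buyers.
  · have h1 := sum_assignedValue_le hμ.payoff_nonneg hμ.price_nonneg hμ.value_le hτ
      (Finset.univ.erase i)
    have h2 := hμ.sum_assignedValue
    rw [← Finset.sum_erase_add _ _ (Finset.mem_univ i)] at hτsum
    rw [← Finset.sum_erase_add _ U (Finset.mem_univ i)] at h2
    rw [assignedValue_none hτi] at hτsum
    linarith
  -- Lower bound: lowering all values of `i` by her marginal contribution `r` makes it optimal to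
  -- leave her out, so `τ` is supported by an equilibrium in which her payoff is 0.
  · let w' : I → J → ℝ := fun k j => if k = i then w k j - r else w k j
    have hw'le : ∀ σ k, k ≠ i → assignedValue w' σ k = assignedValue w σ k := by
      intro σ k hk
      simp [assignedValue, w', hk]
    obtain ⟨q, V, κ, hκ⟩ := exists_isCompetitiveEquilibrium (isUtility_valueMarket w')
    have hτsum' : ∑ k, assignedValue w' τ k = maxValueWithout w i := by
      rw [← hτsum]
      refine Finset.sum_congr rfl fun k _ => ?_
      by_cases hk : k = i
      · rw [hk, assignedValue_none hτi, assignedValue_none hτi]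
      · exact hw'le τ k hk
    have hκsum : ∑ k, assignedValue w' κ k ≤ maxValueWithout w i := by
      rw [← Finset.sum_erase_add _ _ (Finset.mem_univ i)]
      have h1 : ∑ k ∈ Finset.univ.erase i, assignedValue w' κ k =
          ∑ k ∈ Finset.univ.erase i, assignedValue w κ k :=
        Finset.sum_congr rfl fun k hk => hw'le κ k (Finset.ne_of_mem_erase hk)
      rw [h1]
      cases hi : κ i with
      | none =>
        rw [assignedValue_none hi, add_zero]
        exact le_maxValueWithout w i hκ.isMatching
      | some j =>
        have h2 := hμ.isOptimal hκ.isMatching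
        rw [← Finset.sum_erase_add _ _ (Finset.mem_univ i), assignedValue_some hi] at h2
        rw [assignedValue_some hi]
        simp only [w', if_true]
        linarith
    have hVτ : Supports (valueMarket w') q V τ :=
      supports_of_sum_le hκ.payoff_nonneg hκ.price_nonneg hκ.value_le hτ (by
        rw [← hκ.sum_assignedValue]
        linarith)
    have hVi := hVτ.payoff_unmatched i hτi
    have hsum := hVτ.sum_assignedValue
    have hsum' : ∑ k, Function.update V i r k = ∑ k, V k + r := by
      rw [← Finset.sum_erase_add _ _ (Finset.mem_univ i),
        ← Finset.sum_erase_add _ V (Finset.mem_univ i), hVi, Function.update_self, add_zero]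
      congr 1
      exact Finset.sum_congr rfl fun k hk => by simp [Finset.ne_of_mem_erase hk]
    -- Restoring the values and giving `r` to `i` keeps dual feasibility. The dual total becomes the
    -- optimum for `w`, so this is an equilibrium in which `i` gets `r`.
    have heq : Supports (valueMarket w) q (Function.update V i r) μ := by
      refine supports_of_sum_le (fun k => ?_) hκ.price_nonneg (fun k j => ?_) hμ.isMatching ?_
      · by_cases hk : k = i
        · subst hk; simpa using hr0
        · simpa [hk] using hκ.payoff_nonneg k
      · have := hκ.value_le k j
        by_cases hk : k = i
        · subst hk
          simp only [w', if_true, hVi] at this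
          rw [Function.update_self]
          linarith
        · simpa [w', hk] using this
      · rw [hsum']
        linarith
    simpa using (h.2 _ _ ⟨μ, heq⟩).2 i

end Externality

/-! ### Welfare and VCG outcomes in the ad auction -/

section Welfare

variable {I J : Type*} {P : AdAuction I J} {u : I → J → ℝ → ℝ} {c v : I → J → ℝ}
  {p : J → ℝ} {o : Outcome I J}

theorem AdAuction.isUtility_market (P : AdAuction I J) (hu : ∀ i j, IsUtility (u i j)) (i : I)
    (j : J) : IsUtility (P.market u i j) := by
  obtain ⟨hc, ha, x, hx⟩ := hu i j
  cases hk : P.kind i with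
  | perClick =>
    have hpos := P.ctr_pos i j hk
    have heq : P.market u i j = fun x => u i j (x / P.ctr i j) := by
      funext x
      simp [market, personalPrice, hk]
    rw [heq]
    refine ⟨by fun_prop, fun a b hab => ha (by gcongr), x * P.ctr i j, ?_⟩
    rwa [mul_div_cancel_right₀ _ hpos.ne']
  | perImpression =>
    have heq : P.market u i j = u i j := by
      funext x
      simp [market, personalPrice, hk]
    rw [heq]
    exact ⟨hc, ha, x, hx⟩

theorem AdAuction.exists_isMechanismOutcome {U : I → ℝ}
    (h : IsLowestEquilibrium (P.market u) p U) : ∃ o, P.IsMechanismOutcome u p o := by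
  obtain ⟨μ, hμ⟩ := h.1
  refine ⟨⟨μ, hμ.isMatching, fun i => (μ i).elim 0 fun j => P.personalPrice i j (p j), ?_⟩,
    U, h, hμ, ?_⟩
  · intro i hi
    simp [hi]
  · intro i j hij
    change μ i = some j at hij
    simp [hij]

theorem payoff_eq_assignedPayoff
    (h : ∀ i j, o.slot i = some j → o.pay i = P.personalPrice i j (p j)) (i : I) :
    payoff u o i = assignedPayoff (P.market u) o.slot p i := by
  cases hi : o.slot i with
  | none => simp [payoff, assignedPayoff, hi]
  | some j => simp [payoff, assignedPayoff, hi, market, h i j hi]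

theorem AdAuction.expectedPayment_none {i : I} (hi : o.slot i = none) :
    P.expectedPayment o i = 0 := by
  simp [expectedPayment, hi]

theorem AdAuction.expectedPayment_le {i : I} {j : J} (hi : o.slot i = some j) {x : ℝ}
    (h : o.pay i ≤ P.personalPrice i j x) : P.expectedPayment o i ≤ x := by
  cases hk : P.kind i with
  | perClick =>
    simp only [personalPrice, hk] at h
    simp only [expectedPayment, hi, hk, Option.elim_some]
    rwa [le_div_iff₀' (P.ctr_pos i j hk)] at h
  | perImpression =>
    simp only [personalPrice, hk] at h
    simpa only [expectedPayment, hi, hk, Option.elim_some] using h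

theorem AdAuction.expectedPayment_eq_iff {i : I} {j : J} (hi : o.slot i = some j) {x : ℝ} :
    P.expectedPayment o i = x ↔ o.pay i = P.personalPrice i j x := by
  cases hk : P.kind i with
  | perClick =>
    simp only [personalPrice, hk, expectedPayment, hi, Option.elim_some]
    rw [eq_div_iff (P.ctr_pos i j hk).ne', mul_comm]
  | perImpression =>
    simp only [personalPrice, hk, expectedPayment, hi, Option.elim_some]

theorem AdAuction.expectedPayment_eq_elim
    (h : ∀ i j, o.slot i = some j → o.pay i = P.personalPrice i j (p j)) (i : I) :
    P.expectedPayment o i = (o.slot i).elim 0 p := by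
  cases hi : o.slot i with
  | none => exact expectedPayment_none hi
  | some j => exact (expectedPayment_eq_iff hi).2 (h i j hi)

theorem AdAuction.market_eq_of_isStandard {i : I} (hs : P.IsStandard i (c i) (v i) (u i))
    (ha : P.Agrees i (c i)) (j : J) (x : ℝ) :
    P.market u i j x = P.impressionValue c v i j - x := by
  cases hk : P.kind i with
  | perClick =>
    simp only [IsStandard, hk] at hs
    simp only [market, personalPrice, impressionValue, hk, hs, ha hk j]
    field_simp [(P.ctr_pos i j hk).ne']
  | perImpression =>
    simp only [IsStandard, hk] at hs
    simp only [market, personalPrice, impressionValue, hk, hs]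

theorem AdAuction.expectedPayment_add_payoff {i : I} (hs : P.IsStandard i (c i) (v i) (u i))
    (ha : P.Agrees i (c i)) (o : Outcome I J) :
    P.expectedPayment o i + payoff u o i =
      assignedValue (P.impressionValue c v) o.slot i := by
  cases hi : o.slot i with
  | none => simp [expectedPayment, payoff, assignedValue, hi]
  | some j =>
    cases hk : P.kind i with
    | perClick =>
      simp only [IsStandard, hk] at hs
      simp only [expectedPayment, payoff, assignedValue, hi, impressionValue, hk, hs, ha hk j,
        Option.elim_some]
      ring
    | perImpression =>
      simp only [IsStandard, hk] at hs
      simp only [expectedPayment, payoff, assignedValue, hi, impressionValue, hk, hs,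
        Option.elim_some]
      ring

theorem AdAuction.IsMechanismOutcome.welfare_le [Fintype I] [Fintype J] {A : Finset I}
    (hA : ∀ i ∈ A, P.IsStandard i (c i) (v i) (u i) ∧ P.Agrees i (c i))
    (ho : P.IsMechanismOutcome u p o) (o' : Outcome I J)
    (ho' : ∀ i, i ∉ A → ∀ j, o'.slot i = some j → o'.pay i ≤ P.personalPrice i j (p j)) :
    P.welfare u A o' ≤ P.welfare u A o := by
  classical
  obtain ⟨U, -, hs, hpay⟩ := ho
  have hpayoff : ∀ i, payoff u o i = U i := fun i =>
    (payoff_eq_assignedPayoff hpay i).trans (hs.eq_assignedPayoff i).symm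
  have hrhs : P.welfare u A o = ∑ j, p j + ∑ i ∈ A, U i := by
    simp only [welfare, expectedPayment_eq_elim hpay, hpayoff,
      sum_assigned_eq hs.isMatching hs.price_unmatched]
  -- Weak duality buyer by buyer: a member of `A` and the search engine share her value, which the
  -- equilibrium bounds by payoff plus price; an outsider contributes at most the posted price.
  have hlhs : ∀ i, P.expectedPayment o' i + (if i ∈ A then payoff u o' i else 0) ≤
      (o'.slot i).elim 0 p + if i ∈ A then U i else 0 := by
    intro i
    by_cases hi : i ∈ A
    · simp only [hi, if_true]
      obtain ⟨hst, hag⟩ := hA i hi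
      rw [expectedPayment_add_payoff hst hag]
      cases hij : o'.slot i with
      | none => simpa [assignedValue, hij] using hs.payoff_nonneg i
      | some j =>
        have := hs.payoff_ge i j
        rw [market_eq_of_isStandard hst hag] at this
        simp only [assignedValue, hij, Option.elim_some]
        linarith
    · simp only [hi, if_false, add_zero]
      cases hij : o'.slot i with
      | none => simp [expectedPayment, hij]
      | some j => simpa using expectedPayment_le hij (ho' i hi j hij)
  have hsum := Finset.sum_le_sum fun i (_ : i ∈ Finset.univ) => hlhs i
  simp only [Finset.sum_add_distrib, Finset.sum_ite_mem, Finset.univ_inter] at hsum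
  rw [hrhs, welfare]
  linarith [sum_assigned_le hs.price_nonneg o'.isMatching]

open Classical in
/-- An outcome for the advertisers in `A`, as an outcome in which the others get no slot. -/
noncomputable def Outcome.extend {A : Finset I} (o : Outcome A J) : Outcome I J where
  slot i := if h : i ∈ A then o.slot ⟨i, h⟩ else none
  isMatching i i' j hi hi' := by
    dsimp only at hi hi'
    split_ifs at hi hi' with h h'
    exact congrArg Subtype.val (o.isMatching _ _ j hi hi')
  pay i := if h : i ∈ A then o.pay ⟨i, h⟩ else 0
  pay_unmatched i hi := by
    split_ifs at hi ⊢ with h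
    · exact o.pay_unmatched _ hi
    · rfl

theorem AdAuction.welfare_extend [Fintype I] (P : AdAuction I J) (u : I → J → ℝ → ℝ)
    {A : Finset I} (o : Outcome A J) :
    P.welfare u A o.extend = (P.restrict A).welfare (fun i => u i) Finset.univ o := by
  have h1 : ∀ i, i ∉ A → P.expectedPayment o.extend i = 0 := fun i hi =>
    expectedPayment_none (by simp [Outcome.extend, hi])
  have h2 : ∀ i : A, P.expectedPayment o.extend i = (P.restrict A).expectedPayment o i := by
    intro i
    simp [expectedPayment, Outcome.extend, restrict]
  have h3 : ∀ i : A, payoff u o.extend i = payoff (fun i : A => u i) o i := by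
    intro i
    simp [payoff, Outcome.extend]
  rw [welfare, welfare, ← Finset.sum_subset (Finset.subset_univ A) fun i _ hi => h1 i hi,
    ← Finset.sum_coe_sort A, ← Finset.sum_coe_sort A]
  simp only [h2, h3]

/-- If all advertisers are standard and agree with the search engine, then the outcomes of the
mechanism are the VCG outcomes. -/
theorem AdAuction.exists_isMechanismOutcome_iff [Fintype I] [Fintype J] [DecidableEq I]
    (hA : ∀ i, P.IsStandard i (c i) (v i) (u i) ∧ P.Agrees i (c i)) (o : Outcome I J) :
    (∃ p, P.IsMechanismOutcome u p o) ↔ P.IsVCGOutcome (P.impressionValue c v) o := by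
  have hm : P.market u = valueMarket (P.impressionValue c v) := by
    funext i j x
    exact market_eq_of_isStandard (hA i).1 (hA i).2 j x
  set w := P.impressionValue c v
  have hpayment : ∀ {p : J → ℝ} {U : I → ℝ}, IsLowestEquilibrium (valueMarket w) p U →
      Supports (valueMarket w) p U o.slot → ∀ i, (o.slot i).elim 0 p =
        maxValueWithout w i - ∑ k ∈ Finset.univ.erase i, assignedValue w o.slot k := by
    intro p U hlow hs i
    have h1 := hlow.payoff_eq_sub hs i
    have h2 := hs.assignedValue_eq i
    rw [← Finset.sum_erase_add _ _ (Finset.mem_univ i)] at h1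
    linarith
  constructor
  · rintro ⟨p, U, hlow, hs, hpay⟩
    rw [hm] at hlow hs
    refine ⟨fun σ hσ => hs.isOptimal hσ, fun i => ?_⟩
    rw [expectedPayment_eq_elim hpay i]
    exact hpayment hlow hs i
  · rintro ⟨hopt, hpay⟩
    obtain ⟨p, U, hlow⟩ := exists_isLowestEquilibrium (isUtility_valueMarket w)
    obtain ⟨μ, hμ⟩ := hlow.1
    -- Every optimal assignment supports the lowest equilibrium, so the VCG assignment may be used
    -- as it is; the payments then agree by `hpayment`.
    have hs : Supports (valueMarket w) p U o.slot :=
      supports_of_sum_le hμ.payoff_nonneg hμ.price_nonneg hμ.value_le o.isMatching (by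
        rw [← hμ.sum_assignedValue]
        exact hopt μ hμ.isMatching)
    refine ⟨p, U, hm ▸ hlow, hm ▸ hs, fun i j hij => ?_⟩
    rw [← expectedPayment_eq_iff hij, hpay i]
    have := hpayment hlow hs i
    rw [hij] at this
    exact this.symm

end Welfare

theorem mainTheorem4 {I J : Type*} [Fintype I] [Fintype J] [DecidableEq I]
    (P : AdAuction I J) :
    -- the mechanism is well defined: the lowest equilibrium exists and is unique
    (∀ u : I → J → ℝ → ℝ, (∀ i j, IsUtility (u i j)) →
      (∃! W : (J → ℝ) × (I → ℝ), IsLowestEquilibrium (P.market u) W.1 W.2) ∧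
      ∃ p o, P.IsMechanismOutcome u p o) ∧
    -- group strategyproofness: no coalition `S` has a misreport by which all its members gain
    (∀ (S : Finset I) (u u' : I → J → ℝ → ℝ), S.Nonempty →
      (∀ i j, IsUtility (u i j)) → (∀ i j, IsUtility (u' i j)) → (∀ i, i ∉ S → u' i = u i) →
      ∀ p o p' o', P.IsMechanismOutcome u p o → P.IsMechanismOutcome u' p' o' →
        ∃ i ∈ S, payoff u o' i ≤ payoff u o i) ∧
    -- welfare of the search engine and a group `A` of standard advertisers who agree with it
    (∀ (u : I → J → ℝ → ℝ) (c v : I → J → ℝ) (A : Finset I),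
      (∀ i j, IsUtility (u i j)) →
      (∀ i ∈ A, P.IsStandard i (c i) (v i) (u i) ∧ P.Agrees i (c i)) →
      ∀ p o, P.IsMechanismOutcome u p o →
        -- it is maximal among the outcomes in which the others pay at most the posted prices
        (∀ o' : Outcome I J,
          (∀ i, i ∉ A → ∀ j, o'.slot i = some j → o'.pay i ≤ P.personalPrice i j (p j)) →
          P.welfare u A o' ≤ P.welfare u A o) ∧
        -- it is not lower than in the absence of the others
        (∀ pA oA, (P.restrict A).IsMechanismOutcome (fun i => u i) pA oA →
          (P.restrict A).welfare (fun i => u i) Finset.univ oA ≤ P.welfare u A o)) ∧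
    -- if all are standard and agree, the outcomes are exactly the VCG outcomes
    (∀ (u : I → J → ℝ → ℝ) (c v : I → J → ℝ),
      (∀ i j, IsUtility (u i j)) →
      (∀ i, P.IsStandard i (c i) (v i) (u i) ∧ P.Agrees i (c i)) →
      ∀ o, (∃ p, P.IsMechanismOutcome u p o) ↔ P.IsVCGOutcome (P.impressionValue c v) o) := by
  refine ⟨fun u hu => ?_, ?_, ?_, ?_⟩
  · obtain ⟨p, U, h⟩ := exists_isLowestEquilibrium (P.isUtility_market hu)
    refine ⟨⟨(p, U), h, ?_⟩, p, AdAuction.exists_isMechanismOutcome h⟩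
    rintro ⟨q, V⟩ hq
    obtain ⟨rfl, rfl⟩ := hq.unique h
    rfl
  · intro S u u' hS hu _ heq p o p' o' ⟨U, hlow, hs, hpay⟩ ⟨V, _, hs', hpay'⟩
    obtain ⟨i, hi, hle⟩ := hlow.exists_assignedPayoff_le (P.isUtility_market hu) hS
      (u' := P.market u') (fun i hi => by unfold AdAuction.market; rw [heq i hi]) hs'
    refine ⟨i, hi, ?_⟩
    rwa [payoff_eq_assignedPayoff hpay', payoff_eq_assignedPayoff hpay, ← hs.eq_assignedPayoff]
  · intro u c v A _ hA p o ho
    refine ⟨ho.welfare_le hA, fun pA oA _ => ?_⟩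
    rw [← P.welfare_extend u oA]
    -- The bound on the payments of outsiders is vacuous, since they get no slot.
    refine ho.welfare_le hA oA.extend fun i hi j hij => ?_
    simp [Outcome.extend, hi] at hij
  · exact fun u c v _ hA o => AdAuction.exists_isMechanismOutcome_iff hA o
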